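/- **Theorem (The convex order for laws of random probability measures).** For a Polish space $S$, let $\mathcal P(S)$ denote the space of Borel probability measures on $S$ with the topology of weak convergence, and let $\mathcal P(\mathcal P(S))$ denote the set of Borel probability measures on $\mathcal P(S)$. Let $S$ be a Polish space and let $\overline S$ be a metrizable compactification of $S$, that is, a compact metrizable space in which $S$ is homeomorphically embedded as a dense subset. Identify $\mathcal P(S)$ with $\{\mu\in\mathcal P(\overline S):\mu(S)=1\}$. A function $\phi:\mathcal P(\overline S)\to\mathbb R$ is convex if $\phi(a\mu+b\nu)\le a\,\phi(\mu)+b\,\phi(\nu)$ for all $\mu,\nu\in\mathcal P(\overline S)$ and all $a,b\ge 0$ with $a+b=1$. Then, for all $\rho_1,\rho_2\in\mathcal P(\mathcal P(S))$, the following statements are equivalent. 1. $\displaystyle\int\phi\,\mathrm d\rho_1\le\int\phi\,\mathrm d\rho_2$ for all continuous convex functions $\phi:\mathcal P(\overline S)\to\mathbb R$. 2. There exist an $S$-valued random variable $X$ defined on some probability space $(\Omega,\mathcal F,\mathbb P)$ and sub-$\sigma$-fields $\mathcal F_1\subset\mathcal F_2\subset\mathcal F$ such that, for $i=1,2$, $\rho_i=\mathbb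 P\big[\mathbb P[X\in\cdot\,|\,\mathcal F_i]\in\cdot\,\big]$, i.e. $\rho_i$ is the law of the $\mathcal P(S)$-valued random variable given by the (regular) conditional law of $X$ given $\mathcal F_i$. -/

import Mathlib

open MeasureTheory ProbabilityTheory
open scoped NNReal ENNReal

universe u w v

noncomputable section

/-- The convex combination `a μ + b ν` of two probability measures, where `a, b ≥ 0` and
`a + b = 1`. -/
def convexComb {E : Type*} [MeasurableSpace E] (a b : ℝ≥0) (hab : a + b = 1)
    (μ ν : ProbabilityMeasure E) : ProbabilityMeasure E :=
  ⟨a • (μ : Measure E) + b • (ν : Measure E), ⟨by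
    rw [Measure.add_apply, Measure.smul_apply, Measure.smul_apply, measure_univ, measure_univ,
      ENNReal.smul_def, ENNReal.smul_def, smul_eq_mul, smul_eq_mul, mul_one, mul_one]
    exact_mod_cast hab⟩⟩

/-- A real function on the space of probability measures is convex if
`φ (a μ + b ν) ≤ a φ(μ) + b φ(ν)` for all `μ, ν` and all `a, b ≥ 0` with `a + b = 1`. -/
def IsConvexFun {E : Type*} [MeasurableSpace E] (φ : ProbabilityMeasure E → ℝ) : Prop :=
  ∀ (μ ν : ProbabilityMeasure E) (a b : ℝ≥0) (hab : a + b = 1),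
    φ (convexComb a b hab μ ν) ≤ a * φ μ + b * φ ν

/-- `ι` makes `E` a metrizable compactification of `S`: the space `E` is compact and metrizable and
`ι` is a homeomorphism of `S` onto a dense subset of `E`. -/
structure IsMetrizableCompactification {S E : Type*} [TopologicalSpace S] [TopologicalSpace E]
    (ι : S → E) : Prop where
  compactSpace : CompactSpace E
  metrizableSpace : TopologicalSpace.MetrizableSpace E
  isDenseEmbedding : IsDenseEmbedding ι

/-- The image of a probability measure on `S` under a continuous map `ι : S → E`. For an embedding
`ι` this is the identification of probability measures on `S` with probability measures on `E` that
are concentrated on `S`. -/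
def pushforward {S E : Type*} [TopologicalSpace S] [MeasurableSpace S] [BorelSpace S]
    [TopologicalSpace E] [MeasurableSpace E] [BorelSpace E] (ι : S → E) (hι : Continuous ι)
    (μ : ProbabilityMeasure S) : ProbabilityMeasure E :=
  μ.map hι.measurable.aemeasurable

/-- `ξ` is a version of the conditional law `ℙ[X ∈ · | F]`: it is an `F`-measurable random
probability measure with `ξ(A) = ℙ[X ∈ A | F]` almost surely, for every measurable `A`. -/
structure IsCondLaw {Ω S : Type*} {mΩ : MeasurableSpace Ω} [MeasurableSpace S]
    (P : Measure Ω) (X : Ω → S) (F : MeasurableSpace Ω) (ξ : Ω → ProbabilityMeasure S) :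
    Prop where
  measurable : Measurable[F] ξ
  ae_eq : ∀ A : Set S, MeasurableSet A →
    (fun ω => (ξ ω : Measure S).real A) =ᵐ[P] P⟦X ⁻¹' A | F⟧

/-- `ρ` is the law `ℙ[ℙ[X ∈ · | F] ∈ · ]` of the conditional law of `X` given `F`. -/
def IsLawOfCondLaw {Ω S : Type*} {mΩ : MeasurableSpace Ω} [MeasurableSpace S]
    (ρ : ProbabilityMeasure (ProbabilityMeasure S))
    (P : Measure Ω) (X : Ω → S) (F : MeasurableSpace Ω) : Prop :=
  ∃ ξ : Ω → ProbabilityMeasure S, IsCondLaw P X F ξ ∧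
    (ρ : Measure (ProbabilityMeasure S)) = @Measure.map Ω (ProbabilityMeasure S) mΩ _ ξ P

end

/-!
The two directions rest on the compactness and metrizability of the space `K` of probability
measures on the compactification `E`.

*Conditional laws increase in the convex order.* If `ξ₁`, `ξ₂` are the conditional laws of `X` given
`F₁ ≤ F₂`, then the integrals of a test function against `ξ₁`, `ξ₂` form a martingale. A dense
sequence of test functions gives an affine closed embedding of `K` into `ℓ²`
(`momentEmbedding`), so that the martingale property becomes an identity between conditional
expectations in a Hilbert space (`momentEmbedding_ae_eq_condExp`), and the conditional Jensen
inequality on the compact convex image of `K` applies (`integral_le_of_isLawOfCondLaw`). The same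
embedding shows that the Borel `σ`-algebra of `K` is the one generated by the evaluations
`μ ↦ μ A`.

*Laws in convex order come from conditional laws.* A coupling of the two laws whose first coordinate
is the conditional mean of the second is a positive linear functional on `C(K × K)` with prescribed
values on the functions `a μ + b ν + m (μ, ν)`, where `m` is affine in `ν` and vanishes on the
diagonal. By the Riesz extension theorem it exists if the prescribed values are positive, and they
are (`couplingFunctional_nonneg`): if `a μ + b ν + m (μ, ν) ≥ 0`, then
`φ ν = sup_μ (-a μ - m (μ, ν))` is continuous and convex and `-a ≤ φ ≤ b`, so
`-∫ a dρ₁ ≤ ∫ φ dρ₁ ≤ ∫ φ dρ₂ ≤ ∫ b dρ₂`. The Riesz–Markov–Kakutani theorem turns the functional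
into a measure (`exists_martingale_coupling`). If `X` is now sampled from the second coordinate
`ν` of the pair `(μ, ν)`, then `ν` is the conditional law of `X` given `(μ, ν)`, and `μ` is the
conditional law of `X` given `μ` (`exists_isLawOfCondLaw`).
-/

section ConvexOrder

open Filter Topology TopologicalSpace Set

/-! ### The weak topology on probability measures over a compact metrizable space -/

section MomentEmbedding

/-- The Hilbert space `ℓ²` of square summable real sequences. -/
abbrev EllTwo : Type := lp (fun _ : ℕ => ℝ) 2

variable {E : Type*} [TopologicalSpace E] [CompactSpace E]

/-- Nonzero multiples of the terms of a dense sequence of continuous functions, normalized so that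
the `n`-th one has norm at most `2⁻ⁿ`. -/
noncomputable def momentFun (E : Type*) [TopologicalSpace E] [CompactSpace E] [MetrizableSpace E]
    (n : ℕ) : C(E, ℝ) :=
  ((1 / 2 : ℝ) ^ n * (1 + ‖denseSeq C(E, ℝ) n‖)⁻¹) • denseSeq C(E, ℝ) n

lemma norm_momentFun_le [MetrizableSpace E] (n : ℕ) : ‖momentFun E n‖ ≤ (1 / 2) ^ n := by
  rw [momentFun, norm_smul, Real.norm_of_nonneg (by positivity), mul_assoc]
  refine mul_le_of_le_one_right (by positivity) ?_
  rw [inv_mul_le_iff₀ (by positivity)]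
  linarith

lemma MeasureTheory.ProbabilityMeasure.abs_integral_le [MeasurableSpace E]
    (μ : ProbabilityMeasure E) (f : C(E, ℝ)) : |∫ x, f x ∂(μ : Measure E)| ≤ ‖f‖ := by
  have := norm_integral_le_of_norm_le_const (μ := (μ : Measure E)) (f := fun x => f x) (C := ‖f‖)
    (ae_of_all _ fun x => f.norm_coe_le_norm x)
  simpa using this

lemma MeasureTheory.ProbabilityMeasure.integrable_continuousMap [MeasurableSpace E]
    [BorelSpace E] (μ : ProbabilityMeasure E) (f : C(E, ℝ)) :
    Integrable (fun x => f x) (μ : Measure E) :=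
  (BoundedContinuousFunction.mkOfCompact f).integrable _

lemma integral_convexComb [MeasurableSpace E] [BorelSpace E] (a b : ℝ≥0) (hab : a + b = 1)
    (μ ν : ProbabilityMeasure E) (f : C(E, ℝ)) :
    ∫ x, f x ∂(convexComb a b hab μ ν : Measure E) =
      a * ∫ x, f x ∂(μ : Measure E) + b * ∫ x, f x ∂(ν : Measure E) := by
  have h : (convexComb a b hab μ ν : Measure E) = a • (μ : Measure E) + b • (ν : Measure E) := rfl
  rw [h, integral_add_measure ((μ.integrable_continuousMap f).smul_measure_nnreal)
    ((ν.integrable_continuousMap f).smul_measure_nnreal), integral_smul_nnreal_measure,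
    integral_smul_nnreal_measure]
  rfl

variable [MeasurableSpace E] [MetrizableSpace E]

/-- The embedding of the space of probability measures on `E` into the Hilbert space `ℓ²` given by
the integrals of the functions `momentFun E n`. -/
noncomputable def momentEmbedding (μ : ProbabilityMeasure E) : EllTwo :=
  ∑' n, lp.single 2 n (∫ x, momentFun E n x ∂(μ : Measure E))

lemma norm_single_moment_le (n : ℕ) (μ : ProbabilityMeasure E) :
    ‖(lp.single 2 n (∫ x, momentFun E n x ∂(μ : Measure E)) : EllTwo)‖
      ≤ (1 / 2) ^ n := by
  rw [lp.norm_single (by norm_num), Real.norm_eq_abs]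
  exact (μ.abs_integral_le _).trans (norm_momentFun_le n)

lemma hasSum_momentEmbedding (μ : ProbabilityMeasure E) :
    HasSum (fun n => (lp.single 2 n (∫ x, momentFun E n x ∂(μ : Measure E)) :
      EllTwo)) (momentEmbedding μ) :=
  (Summable.of_norm_bounded summable_geometric_two (fun n => norm_single_moment_le n μ)).hasSum

lemma momentEmbedding_apply (μ : ProbabilityMeasure E) (n : ℕ) :
    momentEmbedding μ n = ∫ x, momentFun E n x ∂(μ : Measure E) := by
  have h := (hasSum_momentEmbedding μ).mapL (lp.evalCLM ℝ (fun _ : ℕ => ℝ) 2 n)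
  refine h.unique ?_
  have h1 := hasSum_single (f := fun m => lp.evalCLM ℝ (fun _ : ℕ => ℝ) 2 n
    (lp.single 2 m (∫ x, momentFun E m x ∂(μ : Measure E)))) n
    (fun m hm => lp.single_apply_ne (E := fun _ : ℕ => ℝ) 2 m _ hm.symm)
  rwa [show lp.evalCLM ℝ (fun _ : ℕ => ℝ) 2 n
      (lp.single 2 n (∫ x, momentFun E n x ∂(μ : Measure E))) = _ from
    lp.single_apply_self (E := fun _ : ℕ => ℝ) 2 n _] at h1

variable [BorelSpace E]

lemma continuous_lp_single (n : ℕ) :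
    Continuous fun c : ℝ => (lp.single 2 n c : EllTwo) :=
  (lp.singleContinuousLinearMap ℝ (fun _ : ℕ => ℝ) 2 n).continuous

lemma continuous_momentEmbedding :
    Continuous (momentEmbedding : ProbabilityMeasure E → EllTwo) :=
  continuous_tsum (fun n => (continuous_lp_single n).comp
    (ProbabilityMeasure.continuous_integral_continuousMap (momentFun E n)))
    summable_geometric_two (fun n μ => norm_single_moment_le n μ)

lemma momentEmbedding_injective :
    Function.Injective (momentEmbedding : ProbabilityMeasure E → EllTwo) := by
  intro μ ν h
  have hd (n : ℕ) : ∫ x, denseSeq C(E, ℝ) n x ∂(μ : Measure E) =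
      ∫ x, denseSeq C(E, ℝ) n x ∂(ν : Measure E) := by
    have hn := congr_arg (fun y : EllTwo => y n) h
    simp only [momentEmbedding_apply, momentFun, ContinuousMap.smul_apply, integral_const_mul,
      smul_eq_mul] at hn
    exact mul_left_cancel₀ (by positivity) hn
  have hcont (ν : ProbabilityMeasure E) :
      Continuous fun f : C(E, ℝ) => ∫ x, f x ∂(ν : Measure E) := by
    refine continuous_iff_continuousAt.2 fun f => ?_
    refine tendsto_iff_norm_sub_tendsto_zero.2 ?_
    refine squeeze_zero (fun _ => norm_nonneg _) (g := fun g => ‖g - f‖) (fun g => ?_) ?_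
    · rw [← integral_sub (ν.integrable_continuousMap g) (ν.integrable_continuousMap f)]
      exact ν.abs_integral_le (g - f)
    · exact tendsto_iff_norm_sub_tendsto_zero.1 tendsto_id
  have heq := Continuous.ext_on (denseRange_denseSeq C(E, ℝ)) (hcont μ) (hcont ν)
    (by rintro _ ⟨n, rfl⟩; exact hd n)
  have h : (μ : Measure E) = ν := ext_of_forall_integral_eq_of_IsFiniteMeasure fun f =>
    congr_fun heq f.toContinuousMap
  exact Subtype.ext h

lemma momentEmbedding_convexComb (a b : ℝ≥0) (hab : a + b = 1) (μ ν : ProbabilityMeasure E) :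
    momentEmbedding (convexComb a b hab μ ν) =
      (a : ℝ) • momentEmbedding μ + (b : ℝ) • momentEmbedding ν := by
  refine lp.ext (funext fun n => ?_)
  simp only [lp.coeFn_add, lp.coeFn_smul, Pi.add_apply, Pi.smul_apply, momentEmbedding_apply,
    integral_convexComb, smul_eq_mul]

lemma isClosedEmbedding_momentEmbedding :
    IsClosedEmbedding (momentEmbedding : ProbabilityMeasure E → EllTwo) :=
  continuous_momentEmbedding.isClosedEmbedding momentEmbedding_injective

/-- Integrals of measurable functions are measurable for the `σ`-algebra generated by the
evaluations `μ ↦ μ A`. -/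
lemma MeasureTheory.ProbabilityMeasure.stronglyMeasurable_integral {S : Type*} [MeasurableSpace S]
    {f : S → ℝ} (hf : StronglyMeasurable f) :
    StronglyMeasurable fun μ : ProbabilityMeasure S => ∫ x, f x ∂(μ : Measure S) := by
  let κ : Kernel (ProbabilityMeasure S) S := ⟨fun μ => μ, measurable_subtype_coe⟩
  exact hf.integral_kernel (κ := κ)

lemma stronglyMeasurable_momentEmbedding :
    StronglyMeasurable (momentEmbedding : ProbabilityMeasure E → EllTwo) := by
  refine stronglyMeasurable_of_tendsto atTop
    (f := fun (N : ℕ) (μ : ProbabilityMeasure E) => ∑ n ∈ Finset.range N,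
      (lp.single 2 n (∫ x, momentFun E n x ∂(μ : Measure E)) : EllTwo))
    (fun N => Finset.stronglyMeasurable_fun_sum _ fun n _ => ?_)
    (tendsto_pi_nhds.2 fun μ => (hasSum_momentEmbedding μ).tendsto_sum_nat)
  exact (continuous_lp_single n).comp_stronglyMeasurable
    (ProbabilityMeasure.stronglyMeasurable_integral
      (momentFun E n).continuous.measurable.stronglyMeasurable)

/-- On the space of probability measures over a compact metrizable space, the Borel `σ`-algebra of
the weak topology is generated by the evaluations `μ ↦ μ A`. -/
instance MeasureTheory.ProbabilityMeasure.borelSpace_of_compact :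
    BorelSpace (ProbabilityMeasure E) := by
  refine ⟨le_antisymm ?_ ?_⟩
  · -- Evaluations at open sets are lower semicontinuous, and the open sets form a `π`-system.
    have key : Measurable[borel (ProbabilityMeasure E)]
        (fun μ : ProbabilityMeasure E => (μ : Measure E)) := by
      let : MeasurableSpace (ProbabilityMeasure E) := borel _
      have : BorelSpace (ProbabilityMeasure E) := ⟨rfl⟩
      refine Measurable.measure_of_isPiSystem_of_isProbabilityMeasure
        (BorelSpace.measurable_eq (α := E)) isPiSystem_isOpen fun U hU => ?_
      refine LowerSemicontinuous.measurable (lowerSemicontinuous_iff_le_liminf.2 fun μ => ?_)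
      exact ProbabilityMeasure.le_liminf_measure_open_of_tendsto tendsto_id hU
    exact key.comap_le
  · refine borel_eq_generateFrom_isClosed.le.trans (MeasurableSpace.generateFrom_le fun F hF => ?_)
    borelize EllTwo
    rw [← preimage_image_eq F momentEmbedding_injective]
    exact stronglyMeasurable_momentEmbedding.measurable
      (isClosedEmbedding_momentEmbedding.isClosedMap F hF).measurableSet

end MomentEmbedding

/-! ### Strassen's coupling on the space of probability measures -/

/-- A positive linear functional on the continuous functions on a compact metrizable space is
integration against a finite measure. -/
lemma exists_measure_integral_eq {X : Type*} [TopologicalSpace X] [CompactSpace X] [T2Space X]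
    [MeasurableSpace X] [BorelSpace X] (g : C(X, ℝ) →ₗ[ℝ] ℝ) (hg : ∀ f, 0 ≤ f → 0 ≤ g f) :
    ∃ π : Measure X, IsFiniteMeasure π ∧ ∀ f : C(X, ℝ), ∫ x, f x ∂π = g f := by
  let Λ : CompactlySupportedContinuousMap X ℝ →ₚ[ℝ] ℝ :=
    { toFun := fun f => g f.toContinuousMap
      map_add' := fun f f' => map_add g f.toContinuousMap f'.toContinuousMap
      map_smul' := fun c f => map_smul g c f.toContinuousMap
      monotone' := fun f f' h => by
        have := hg (f'.toContinuousMap - f.toContinuousMap)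
          (fun x => sub_nonneg.2 (h x))
        rw [map_sub] at this
        exact sub_nonneg.1 this }
  exact ⟨RealRMK.rieszMeasure Λ, inferInstance, fun f =>
    RealRMK.integral_rieszMeasure Λ ⟨f, HasCompactSupport.of_compactSpace f⟩⟩

section Coupling

variable {E : Type*} [TopologicalSpace E] [MeasurableSpace E] [BorelSpace E]

/-- The continuous functions `m` of two probability measures which vanish on the diagonal and are
affine in the second variable. The second marginal of a coupling is in the mean equal to the first,
conditionally on the first, exactly if the coupling annihilates these functions. -/
noncomputable def diagonalAffine (E : Type*) [TopologicalSpace E] [MeasurableSpace E]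
    [BorelSpace E] : Submodule ℝ C(ProbabilityMeasure E × ProbabilityMeasure E, ℝ) where
  carrier := {m | (∀ μ, m (μ, μ) = 0) ∧ ∀ (μ ν ν' : ProbabilityMeasure E) (a b : ℝ≥0)
    (hab : a + b = 1), m (μ, convexComb a b hab ν ν') = a * m (μ, ν) + b * m (μ, ν')}
  add_mem' := by
    rintro m m' ⟨h1, h2⟩ ⟨h1', h2'⟩
    refine ⟨fun μ => by simp [h1, h1'], fun μ ν ν' a b hab => ?_⟩
    simp only [ContinuousMap.add_apply, h2, h2']
    ring
  zero_mem' := by simp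
  smul_mem' := by
    rintro c m ⟨h1, h2⟩
    refine ⟨fun μ => by simp [h1], fun μ ν ν' a b hab => ?_⟩
    simp only [ContinuousMap.smul_apply, h2, smul_eq_mul]
    ring

/-- The functions `(μ, ν) ↦ a μ + b ν + m (μ, ν)` with `m` vanishing on the diagonal and affine in
the second variable. -/
noncomputable def couplingSum (E : Type*) [TopologicalSpace E] [MeasurableSpace E] [BorelSpace E] :
    (C(ProbabilityMeasure E, ℝ) × C(ProbabilityMeasure E, ℝ)) × diagonalAffine E →ₗ[ℝ]
      C(ProbabilityMeasure E × ProbabilityMeasure E, ℝ) where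
  toFun p := p.1.1.comp .fst + p.1.2.comp .snd + p.2.1
  map_add' p q := by
    ext x
    simp only [Prod.fst_add, Prod.snd_add, Submodule.coe_add, ContinuousMap.add_apply,
      ContinuousMap.comp_apply]
    ring
  map_smul' c p := by
    ext x
    simp only [Prod.smul_fst, Prod.smul_snd, Submodule.coe_smul, ContinuousMap.add_apply,
      ContinuousMap.smul_apply, ContinuousMap.comp_apply, smul_eq_mul, RingHom.id_apply]
    ring

lemma couplingSum_apply (a b : C(ProbabilityMeasure E, ℝ)) (m : diagonalAffine E)
    (μ ν : ProbabilityMeasure E) :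
    couplingSum E ((a, b), m) (μ, ν) = a μ + b ν + (m : C(_, ℝ)) (μ, ν) := rfl

variable [CompactSpace E] [MetrizableSpace E]

/-- The linear functional which a coupling of `ρ₁` and `ρ₂` annihilating `diagonalAffine E` induces
through `couplingSum`. -/
noncomputable def couplingFunctional (ρ₁ ρ₂ : Measure (ProbabilityMeasure E))
    [IsProbabilityMeasure ρ₁] [IsProbabilityMeasure ρ₂] :
    (C(ProbabilityMeasure E, ℝ) × C(ProbabilityMeasure E, ℝ)) × diagonalAffine E →ₗ[ℝ] ℝ where
  toFun p := ∫ μ, p.1.1 μ ∂ρ₁ + ∫ μ, p.1.2 μ ∂ρ₂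
  map_add' p q := by
    have h (ρ : Measure (ProbabilityMeasure E)) [IsProbabilityMeasure ρ]
        (f : C(ProbabilityMeasure E, ℝ)) : Integrable (fun μ => f μ) ρ :=
      (BoundedContinuousFunction.mkOfCompact f).integrable _
    simp only [Prod.fst_add, Prod.snd_add, ContinuousMap.add_apply]
    rw [integral_add (h ρ₁ _) (h ρ₁ _), integral_add (h ρ₂ _) (h ρ₂ _)]
    ring
  map_smul' c p := by
    simp only [Prod.smul_fst, Prod.smul_snd, ContinuousMap.smul_apply,
      smul_eq_mul, integral_const_mul, RingHom.id_apply]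
    ring

/-- The convex order makes the functional `couplingFunctional` positive: if
`a μ + b ν + m (μ, ν) ≥ 0` everywhere, then the supremum `φ ν` of `-a μ - m (μ, ν)` over `μ` is
continuous and convex, and `-a ≤ φ ≤ b`. -/
lemma couplingFunctional_nonneg {ρ₁ ρ₂ : Measure (ProbabilityMeasure E)} [IsProbabilityMeasure ρ₁]
    [IsProbabilityMeasure ρ₂]
    (h : ∀ φ : ProbabilityMeasure E → ℝ, Continuous φ → IsConvexFun φ →
      ∫ μ, φ μ ∂ρ₁ ≤ ∫ μ, φ μ ∂ρ₂)
    (p : (C(ProbabilityMeasure E, ℝ) × C(ProbabilityMeasure E, ℝ)) × diagonalAffine E)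
    (hp : 0 ≤ couplingSum E p) : 0 ≤ couplingFunctional ρ₁ ρ₂ p := by
  obtain ⟨⟨a, b⟩, m, hm⟩ := p
  have hp' (μ ν : ProbabilityMeasure E) : 0 ≤ a μ + b ν + m (μ, ν) := by
    have := hp (μ, ν)
    exact this
  have : Nonempty (ProbabilityMeasure E) := nonempty_of_isProbabilityMeasure ρ₁
  have hc (ν : ProbabilityMeasure E) : Continuous fun μ => -a μ - m (μ, ν) := by fun_prop
  let φ : ProbabilityMeasure E → ℝ := fun ν => sSup ((fun μ => -a μ - m (μ, ν)) '' univ)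
  have hle (μ ν : ProbabilityMeasure E) : -a μ - m (μ, ν) ≤ φ ν :=
    le_csSup (isCompact_univ.image (hc ν)).bddAbove (mem_image_of_mem _ (mem_univ μ))
  have hge (ν : ProbabilityMeasure E) (c : ℝ) (hc : ∀ μ, -a μ - m (μ, ν) ≤ c) : φ ν ≤ c :=
    csSup_le (univ_nonempty.image _) (by rintro _ ⟨μ, -, rfl⟩; exact hc μ)
  have hφ : Continuous φ :=
    isCompact_univ.continuous_sSup (f := fun ν μ => -a μ - m (μ, ν)) (by fun_prop)
  have hconv : IsConvexFun φ := by
    intro ν ν' s t hst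
    refine hge _ _ fun μ => ?_
    have h1 := mul_le_mul_of_nonneg_left (hle μ ν) s.2
    have h2 := mul_le_mul_of_nonneg_left (hle μ ν') t.2
    have hst' : (s : ℝ) + t = 1 := by exact_mod_cast hst
    rw [hm.2]
    change (s : ℝ) * _ ≤ s * _ at h1
    change (t : ℝ) * _ ≤ t * _ at h2
    have h3 : a μ = s * a μ + t * a μ := by rw [← add_mul, hst', one_mul]
    linarith
  have hi (ρ : Measure (ProbabilityMeasure E)) [IsProbabilityMeasure ρ]
      {f : ProbabilityMeasure E → ℝ} (hf : Continuous f) : Integrable f ρ :=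
    (BoundedContinuousFunction.mkOfCompact ⟨f, hf⟩).integrable _
  have h1 : ∫ μ, -a μ ∂ρ₁ ≤ ∫ μ, φ μ ∂ρ₁ := by
    refine integral_mono (hi ρ₁ (by fun_prop)) (hi ρ₁ hφ) fun μ => ?_
    have := hle μ μ
    rwa [hm.1, sub_zero] at this
  have h2 : ∫ μ, φ μ ∂ρ₂ ≤ ∫ μ, b μ ∂ρ₂ :=
    integral_mono (hi ρ₂ hφ) (hi ρ₂ b.continuous) fun ν => hge _ _ fun μ => by
      linarith [hp' μ ν]
  rw [integral_neg] at h1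
  change 0 ≤ ∫ μ, a μ ∂ρ₁ + ∫ μ, b μ ∂ρ₂
  linarith [h φ hφ hconv]

/-- **Strassen's theorem** on the space of probability measures: two laws in convex order have a
coupling under which the first coordinate is the conditional mean of the second. -/
theorem exists_martingale_coupling {ρ₁ ρ₂ : Measure (ProbabilityMeasure E)}
    [IsProbabilityMeasure ρ₁] [IsProbabilityMeasure ρ₂]
    (h : ∀ φ : ProbabilityMeasure E → ℝ, Continuous φ → IsConvexFun φ →
      ∫ μ, φ μ ∂ρ₁ ≤ ∫ μ, φ μ ∂ρ₂) :
    ∃ π : Measure (ProbabilityMeasure E × ProbabilityMeasure E), IsProbabilityMeasure π ∧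
      π.map Prod.fst = ρ₁ ∧ π.map Prod.snd = ρ₂ ∧
      ∀ (a : C(ProbabilityMeasure E, ℝ)) (f : C(E, ℝ)),
        ∫ p, a p.1 * ∫ x, f x ∂(p.2 : Measure E) ∂π =
          ∫ p, a p.1 * ∫ x, f x ∂(p.1 : Measure E) ∂π := by
  let L := couplingSum E
  let ℓ := couplingFunctional ρ₁ ρ₂
  have hpos := couplingFunctional_nonneg h
  -- Positivity applied to `p` and to `-p` makes `ℓ` factor through the range of `L`.
  have hker : LinearMap.ker L ≤ LinearMap.ker ℓ := fun p hp => by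
    have hp0 : L p = 0 := hp
    have h1 : 0 ≤ ℓ p := hpos p (by change 0 ≤ L p; rw [hp0])
    have h2 : 0 ≤ ℓ (-p) := hpos (-p) (by change 0 ≤ L (-p); rw [map_neg, hp0, neg_zero])
    rw [map_neg] at h2
    exact le_antisymm (by linarith) h1
  let F : C(ProbabilityMeasure E × ProbabilityMeasure E, ℝ) →ₗ.[ℝ] ℝ :=
    ⟨LinearMap.range L, (LinearMap.ker L).liftQ ℓ hker ∘ₗ L.quotKerEquivRange.symm.toLinearMap⟩
  have hF (p) (hp : L p ∈ LinearMap.range L) : F ⟨L p, hp⟩ = ℓ p := by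
    change (LinearMap.ker L).liftQ ℓ hker (L.quotKerEquivRange.symm ⟨L p, hp⟩) = ℓ p
    rw [LinearMap.quotKerEquivRange_symm_apply_image]
    rfl
  obtain ⟨g, hgF, hg⟩ := riesz_extension
    (PointedCone.positive ℝ C(ProbabilityMeasure E × ProbabilityMeasure E, ℝ)) F
    (by
      rintro ⟨_, p, rfl⟩ hx
      exact (hpos p hx).trans_eq (hF p ⟨p, rfl⟩).symm)
    (by
      intro y
      refine ⟨⟨L ((ContinuousMap.const _ ‖y‖, 0), 0), _, rfl⟩, fun q => ?_⟩
      have h1 := neg_le_of_abs_le (y.norm_coe_le_norm q)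
      change (0 : ℝ) ≤ couplingSum E ((ContinuousMap.const _ ‖y‖, 0), 0) q + y q
      rw [couplingSum_apply, ContinuousMap.const_apply, ContinuousMap.zero_apply,
        Submodule.coe_zero, ContinuousMap.zero_apply]
      linarith)
  have hgL (p) : g (L p) = ℓ p := by rw [← hF p ⟨p, rfl⟩, ← hgF]
  obtain ⟨π, hπ, hπg⟩ := exists_measure_integral_eq g (fun f hf => hg f hf)
  have hfst : π.map Prod.fst = ρ₁ := by
    refine ext_of_forall_integral_eq_of_IsFiniteMeasure fun f => ?_
    rw [integral_map measurable_fst.aemeasurable f.continuous.aestronglyMeasurable]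
    have hL : L ((f.toContinuousMap, 0), 0) = f.toContinuousMap.comp .fst := by
      ext p
      rw [couplingSum_apply]
      simp
    have h1 := hgL ((f.toContinuousMap, 0), 0)
    rw [hL, ← hπg] at h1
    refine h1.trans ?_
    change ∫ μ, f μ ∂ρ₁ + ∫ μ, (0 : ℝ) ∂ρ₂ = _
    simp
  have hsnd : π.map Prod.snd = ρ₂ := by
    refine ext_of_forall_integral_eq_of_IsFiniteMeasure fun f => ?_
    rw [integral_map measurable_snd.aemeasurable f.continuous.aestronglyMeasurable]
    have hL : L ((0, f.toContinuousMap), 0) = f.toContinuousMap.comp .snd := by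
      ext p
      rw [couplingSum_apply]
      simp
    have h1 := hgL ((0, f.toContinuousMap), 0)
    rw [hL, ← hπg] at h1
    refine h1.trans ?_
    change ∫ μ, (0 : ℝ) ∂ρ₁ + ∫ μ, f μ ∂ρ₂ = _
    simp
  refine ⟨π, ?_, hfst, hsnd, fun a f => ?_⟩
  · refine ⟨?_⟩
    rw [← preimage_univ (f := Prod.fst), ← Measure.map_apply measurable_fst .univ, hfst,
      measure_univ]
  · have hc : Continuous fun μ : ProbabilityMeasure E => ∫ x, f x ∂(μ : Measure E) :=
      ProbabilityMeasure.continuous_integral_continuousMap f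
    have hc₁ : Continuous fun p : ProbabilityMeasure E × ProbabilityMeasure E =>
        a p.1 * ∫ x, f x ∂(p.1 : Measure E) := by
      exact (a.continuous.comp continuous_fst).mul (hc.comp continuous_fst)
    have hc₂ : Continuous fun p : ProbabilityMeasure E × ProbabilityMeasure E =>
        a p.1 * ∫ x, f x ∂(p.2 : Measure E) := by
      exact (a.continuous.comp continuous_fst).mul (hc.comp continuous_snd)
    let m : C(ProbabilityMeasure E × ProbabilityMeasure E, ℝ) :=
      ⟨fun p => a p.1 * ∫ x, f x ∂(p.2 : Measure E) - a p.1 * ∫ x, f x ∂(p.1 : Measure E),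
        hc₂.sub hc₁⟩
    have hm : m ∈ diagonalAffine E := by
      refine ⟨fun μ => sub_self _, fun μ ν ν' s t hst => ?_⟩
      have hst' : (s : ℝ) + t = 1 := by exact_mod_cast hst
      simp only [m, ContinuousMap.coe_mk, integral_convexComb]
      linear_combination (a μ * ∫ x, f x ∂(μ : Measure E)) * hst'
    have h0 : ∫ p, m p ∂π = 0 := by
      have h1 := hgL ((0, 0), ⟨m, hm⟩)
      have h2 : L ((0, 0), ⟨m, hm⟩) = m := by ext p; rw [couplingSum_apply]; simp
      have h3 : ℓ ((0, 0), ⟨m, hm⟩) = 0 := by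
        change ∫ μ, (0 : ℝ) ∂ρ₁ + ∫ μ, (0 : ℝ) ∂ρ₂ = 0; simp
      rw [hπg, ← h2, h1, h3]
    have hi {k : ProbabilityMeasure E × ProbabilityMeasure E → ℝ} (hk : Continuous k) :
        Integrable k π := (BoundedContinuousFunction.mkOfCompact ⟨k, hk⟩).integrable _
    simp only [m, ContinuousMap.coe_mk] at h0
    rw [integral_sub (hi hc₂) (hi hc₁)] at h0
    exact sub_eq_zero.1 h0

end Coupling

/-! ### Conditional laws increase in the convex order -/

section CondLaw

variable {Ω S : Type*} {F mΩ : MeasurableSpace Ω} [MeasurableSpace S]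

/-- On an event `G` of the conditioning `σ`-algebra, the conditional law averages to the law
of `X`. -/
lemma IsCondLaw.setIntegral_integral {P : Measure Ω} [IsProbabilityMeasure P] {X : Ω → S}
    {ξ : Ω → ProbabilityMeasure S} (hξ : IsCondLaw P X F ξ)
    (hF : F ≤ mΩ) (hX : Measurable X) {G : Set Ω} (hG : MeasurableSet[F] G)
    {f : S → ℝ} (hf : Measurable f) {C : ℝ} (hC : ∀ x, |f x| ≤ C) :
    ∫ ω in G, ∫ x, f x ∂(ξ ω : Measure S) ∂P = ∫ ω in G, f (X ω) ∂P := by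
  have hξm : Measurable ξ := hξ.measurable.mono hF le_rfl
  let κ : Kernel Ω S := ⟨fun ω => ξ ω, measurable_subtype_coe.comp hξm⟩
  have : IsMarkovKernel κ := ⟨fun ω => (ξ ω).2⟩
  have hsnd : (P.restrict G ⊗ₘ κ).map Prod.snd = (P.restrict G).map X := by
    refine Measure.ext fun A hA => ?_
    change (P.restrict G ⊗ₘ κ).snd A = _
    rw [Measure.snd_compProd, Measure.bind_apply hA κ.aemeasurable, Measure.map_apply hX hA]
    -- The real-valued identity is the definition of the conditional expectation of `1_{X ∈ A}`.
    have h1 : ∫ ω in G, (κ ω).real A ∂P = P.real (X ⁻¹' A ∩ G) := by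
      have h0 := setIntegral_congr_ae (hF _ hG) ((hξ.ae_eq A hA).mono fun ω h _ => h)
      refine h0.trans ?_
      rw [setIntegral_condExp hF ((integrable_const _).indicator (hX hA)) hG,
        integral_indicator_const _ (hX hA), measureReal_restrict_apply (hX hA), smul_eq_mul,
        mul_one]
    have h2 : ∫⁻ ω in G, κ ω A ∂P = ENNReal.ofReal (∫ ω in G, (κ ω).real A ∂P) := by
      rw [ofReal_integral_eq_lintegral_ofReal]
      · exact lintegral_congr fun ω => (ofReal_measureReal).symm
      · refine Integrable.of_bound
          ((κ.measurable_coe hA).ennreal_toReal.aestronglyMeasurable) 1 (ae_of_all _ fun ω => ?_)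
        rw [Real.norm_of_nonneg measureReal_nonneg]
        exact measureReal_le_one
      · exact ae_of_all _ fun ω => measureReal_nonneg
    rw [h2, h1, ofReal_measureReal, Measure.restrict_apply (hX hA)]
  have hint : Integrable (fun p : Ω × S => f p.2) (P.restrict G ⊗ₘ κ) :=
    Integrable.of_bound (hf.comp measurable_snd).aestronglyMeasurable C
      (ae_of_all _ fun p => hC p.2)
  have h3 := Measure.integral_compProd hint
  rw [← integral_map hX.aemeasurable hf.aestronglyMeasurable, ← hsnd,
    integral_map measurable_snd.aemeasurable hf.aestronglyMeasurable, h3]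
  rfl

end CondLaw

section Pushforward

variable {S E : Type*} [TopologicalSpace S] [MeasurableSpace S] [BorelSpace S]
  [TopologicalSpace E] [MeasurableSpace E] [BorelSpace E] {ι : S → E} (hι : Continuous ι)

lemma integral_pushforward (μ : ProbabilityMeasure S) (f : C(E, ℝ)) :
    ∫ x, f x ∂(pushforward ι hι μ : Measure E) = ∫ x, f (ι x) ∂(μ : Measure S) :=
  integral_map hι.measurable.aemeasurable f.continuous.aestronglyMeasurable

lemma measurable_pushforward : Measurable (pushforward ι hι) :=
  ((Measure.measurable_map ι hι.measurable).comp measurable_subtype_coe).subtype_mk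

variable [CompactSpace E] [MetrizableSpace E]

lemma integrable_momentEmbedding {Ω : Type*} {mΩ : MeasurableSpace Ω} {P : Measure Ω}
    [IsFiniteMeasure P] {ξ : Ω → ProbabilityMeasure E} (hξ : Measurable ξ) :
    Integrable (fun ω => momentEmbedding (ξ ω)) P := by
  obtain ⟨C, hC⟩ := (isCompact_range (continuous_momentEmbedding (E := E))).isBounded.exists_norm_le
  exact Integrable.of_bound
    (stronglyMeasurable_momentEmbedding.comp_measurable hξ).aestronglyMeasurable C
    (ae_of_all _ fun ω => hC _ (mem_range_self _))

/-- Over an event of the conditioning `σ`-algebra, the coordinates of `momentEmbedding` of the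
conditional law average to test functions of `X`, which do not involve the `σ`-algebra. -/
lemma IsCondLaw.setIntegral_momentEmbedding {Ω : Type*} {F mΩ : MeasurableSpace Ω} {P : Measure Ω}
    [IsProbabilityMeasure P] {X : Ω → S} {ξ : Ω → ProbabilityMeasure S} (hξ : IsCondLaw P X F ξ)
    (hF : F ≤ mΩ) (hX : Measurable X) {G : Set Ω} (hG : MeasurableSet[F] G) (n : ℕ) :
    (∫ ω in G, momentEmbedding (pushforward ι hι (ξ ω)) ∂P : EllTwo) n =
      ∫ ω in G, momentFun E n (ι (X ω)) ∂P := by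
  have hi := integrable_momentEmbedding (P := P)
    ((measurable_pushforward hι).comp (hξ.measurable.mono hF le_rfl))
  have h1 := (lp.evalCLM ℝ (fun _ : ℕ => ℝ) 2 n).integral_comp_comm
    (hi.integrableOn (s := G))
  refine h1.symm.trans (Eq.trans ?_ (hξ.setIntegral_integral hF hX hG
    ((momentFun E n).continuous.comp hι).measurable
    (fun x => (momentFun E n).norm_coe_le_norm (ι x))))
  refine integral_congr_ae (ae_of_all _ fun ω => ?_)
  exact (momentEmbedding_apply _ n).trans (integral_pushforward hι _ _)

/-- Conditional laws form a martingale: given the smaller `σ`-algebra, the conditional mean of the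
conditional law given the larger one is the conditional law given the smaller one. -/
lemma momentEmbedding_ae_eq_condExp {Ω : Type*} {F₁ F₂ mΩ : MeasurableSpace Ω}
    {P : Measure Ω} [IsProbabilityMeasure P] {X : Ω → S} (hX : Measurable X)
    (h₁₂ : F₁ ≤ F₂) (h₂ : F₂ ≤ mΩ) {ξ₁ ξ₂ : Ω → ProbabilityMeasure S}
    (hξ₁ : IsCondLaw P X F₁ ξ₁) (hξ₂ : IsCondLaw P X F₂ ξ₂) :
    (fun ω => momentEmbedding (pushforward ι hι (ξ₁ ω))) =ᵐ[P]
      P[fun ω => momentEmbedding (pushforward ι hι (ξ₂ ω)) | F₁] := by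
  have hj := measurable_pushforward hι
  have hi₁ := integrable_momentEmbedding (P := P)
    (hj.comp (hξ₁.measurable.mono (h₁₂.trans h₂) le_rfl))
  have hi₂ := integrable_momentEmbedding (P := P)
    (hj.comp (hξ₂.measurable.mono h₂ le_rfl))
  refine ae_eq_condExp_of_forall_setIntegral_eq (h₁₂.trans h₂) hi₂
    (fun _ _ _ => hi₁.integrableOn) (fun G hG _ => ?_)
    (stronglyMeasurable_momentEmbedding.comp_measurable
      (hj.comp hξ₁.measurable)).aestronglyMeasurable
  refine lp.ext (funext fun n => ?_)
  rw [hξ₁.setIntegral_momentEmbedding hι (h₁₂.trans h₂) hX hG,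
    hξ₂.setIntegral_momentEmbedding hι h₂ hX (h₁₂ _ hG)]

/-- A continuous convex function on the space of probability measures becomes a continuous convex
function on the image of `momentEmbedding`. -/
lemma exists_convexOn_range_momentEmbedding {φ : ProbabilityMeasure E → ℝ} (hφ : Continuous φ)
    (hconv : IsConvexFun φ) :
    ∃ ψ : EllTwo → ℝ, (∀ μ, ψ (momentEmbedding μ) = φ μ) ∧
      ConvexOn ℝ (range (momentEmbedding (E := E))) ψ ∧
      ContinuousOn ψ (range (momentEmbedding (E := E))) := by
  rcases isEmpty_or_nonempty (ProbabilityMeasure E) with hE | hE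
  · refine ⟨0, fun μ => hE.elim μ, ?_, continuousOn_const⟩
    rw [range_eq_empty]
    exact ⟨convex_empty, fun x hx => hx.elim⟩
  have hψ (μ : ProbabilityMeasure E) :
      (φ ∘ Function.invFun momentEmbedding) (momentEmbedding μ) = φ μ :=
    congr_arg φ (Function.leftInverse_invFun momentEmbedding_injective μ)
  have hcomb (μ ν : ProbabilityMeasure E) {a b : ℝ} (ha : 0 ≤ a) (hb : 0 ≤ b) (hab : a + b = 1) :
      ∃ τ : ProbabilityMeasure E,
        momentEmbedding τ = a • momentEmbedding μ + b • momentEmbedding ν ∧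
          φ τ ≤ a * φ μ + b * φ ν := by
    lift a to ℝ≥0 using ha
    lift b to ℝ≥0 using hb
    have hab' : a + b = 1 := by exact_mod_cast hab
    exact ⟨convexComb a b hab' μ ν, momentEmbedding_convexComb a b hab' μ ν,
      hconv μ ν a b hab'⟩
  refine ⟨φ ∘ Function.invFun momentEmbedding, hψ, ⟨?_, ?_⟩, ?_⟩
  · rintro _ ⟨μ, rfl⟩ _ ⟨ν, rfl⟩ a b ha hb hab
    obtain ⟨τ, hτ, -⟩ := hcomb μ ν ha hb hab
    exact ⟨τ, hτ⟩
  · rintro _ ⟨μ, rfl⟩ _ ⟨ν, rfl⟩ a b ha hb hab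
    obtain ⟨τ, hτ, hle⟩ := hcomb μ ν ha hb hab
    rw [← hτ, hψ, hψ, hψ]
    exact hle
  · rintro _ ⟨μ, rfl⟩
    rw [ContinuousWithinAt, ← isClosedEmbedding_momentEmbedding.isEmbedding.map_nhds_eq,
      tendsto_map'_iff, hψ, show (φ ∘ Function.invFun momentEmbedding) ∘ momentEmbedding = φ from
        funext hψ]
    exact hφ.tendsto μ

/-- Conditioning on a larger `σ`-algebra increases the law of the conditional law in the convex
order. -/
theorem integral_le_of_isLawOfCondLaw {Ω : Type*} {F₁ F₂ mΩ : MeasurableSpace Ω}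
    {P : Measure Ω} [IsProbabilityMeasure P] {X : Ω → S} (hX : Measurable X)
    (h₁₂ : F₁ ≤ F₂) (h₂ : F₂ ≤ mΩ) {ρ₁ ρ₂ : ProbabilityMeasure (ProbabilityMeasure S)}
    (hρ₁ : IsLawOfCondLaw ρ₁ P X F₁) (hρ₂ : IsLawOfCondLaw ρ₂ P X F₂)
    {φ : ProbabilityMeasure E → ℝ} (hφ : Continuous φ) (hconv : IsConvexFun φ) :
    ∫ μ, φ (pushforward ι hι μ) ∂(ρ₁ : Measure (ProbabilityMeasure S)) ≤
      ∫ μ, φ (pushforward ι hι μ) ∂(ρ₂ : Measure (ProbabilityMeasure S)) := by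
  obtain ⟨ξ₁, hξ₁, hρ₁⟩ := hρ₁
  obtain ⟨ξ₂, hξ₂, hρ₂⟩ := hρ₂
  have hm₁ : Measurable ξ₁ := hξ₁.measurable.mono (h₁₂.trans h₂) le_rfl
  have hm₂ : Measurable ξ₂ := hξ₂.measurable.mono h₂ le_rfl
  have hj := measurable_pushforward hι
  have hφj : Measurable fun μ => φ (pushforward ι hι μ) := hφ.measurable.comp hj
  rw [hρ₁, hρ₂, integral_map hm₁.aemeasurable hφj.aestronglyMeasurable,
    integral_map hm₂.aemeasurable hφj.aestronglyMeasurable]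
  obtain ⟨C, hC⟩ := (isCompact_range hφ).isBounded.exists_norm_le
  have hint {ξ : Ω → ProbabilityMeasure S} (hξ : Measurable ξ) :
      Integrable (fun ω => φ (pushforward ι hι (ξ ω))) P :=
    Integrable.of_bound (hφj.comp hξ).aestronglyMeasurable C
      (ae_of_all _ fun ω => hC _ (mem_range_self _))
  obtain ⟨ψ, hψ, hψconv, hψcont⟩ := exists_convexOn_range_momentEmbedding hφ hconv
  have hψξ : (ψ ∘ fun ω => momentEmbedding (pushforward ι hι (ξ₂ ω))) =
      fun ω => φ (pushforward ι hι (ξ₂ ω)) := funext fun ω => hψ _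
  have hJensen := hψconv.map_condExp_le (μ := P) (h₁₂.trans h₂)
    hψcont.lowerSemicontinuousOn
    (ae_of_all _ fun ω => mem_range_self (pushforward ι hι (ξ₂ ω)))
    isClosedEmbedding_momentEmbedding.isClosed_range
    (integrable_momentEmbedding (hj.comp hm₂)) (by rw [hψξ]; exact hint hm₂)
  rw [hψξ] at hJensen
  rw [← integral_condExp (h₁₂.trans h₂) (f := fun ω => φ (pushforward ι hι (ξ₂ ω)))]
  refine integral_mono_ae (hint hm₁) integrable_condExp ?_
  filter_upwards [hJensen, momentEmbedding_ae_eq_condExp hι hX h₁₂ h₂ hξ₁ hξ₂] with ω h1 h2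
  rw [Function.comp_apply, ← h2, hψ] at h1
  exact h1

end Pushforward

/-! ### Realizing the coupling by conditional laws -/

section Realization

/-- The tautological Markov kernel, which sends a probability measure to itself. -/
noncomputable def tautKernel (E : Type*) [MeasurableSpace E] : Kernel (ProbabilityMeasure E) E :=
  ⟨fun μ => μ, measurable_subtype_coe⟩

instance isMarkovKernel_tautKernel (E : Type*) [MeasurableSpace E] :
    IsMarkovKernel (tautKernel E) := ⟨fun μ => μ.2⟩

/-- If the joint law of `W` and `X` is that of a sample from the random measure `k ∘ W`, then
`k ∘ W` is the conditional law of `X` given the `σ`-algebra generated by `W`. -/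
lemma isCondLaw_comap_of_map_eq {Ω S β : Type*} {mΩ : MeasurableSpace Ω} [MeasurableSpace S]
    [StandardBorelSpace S] [Nonempty S] [mβ : MeasurableSpace β] {P : Measure Ω}
    [IsProbabilityMeasure P] {W : Ω → β} (hW : Measurable W) {X : Ω → S} (hX : Measurable X)
    {k : β → ProbabilityMeasure S} (hk : Measurable k)
    (h : P.map (fun ω => (W ω, X ω)) = P.map W ⊗ₘ (tautKernel S).comap k hk) :
    IsCondLaw P X (mβ.comap W) (fun ω => k (W ω)) := by
  refine ⟨hk.comp (comap_measurable W), fun A hA => ?_⟩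
  have h1 := ae_of_ae_map hW.aemeasurable
    (condDistrib_ae_eq_of_measure_eq_compProd W hX.aemeasurable h)
  refine EventuallyEq.trans ?_ (condDistrib_ae_eq_condExp hW hX hA)
  filter_upwards [h1] with ω hω
  rw [hω]
  rfl

variable {E : Type*} [TopologicalSpace E] [MeasurableSpace E] [BorelSpace E] [CompactSpace E]
  [MetrizableSpace E]

/-- Under a coupling whose first coordinate is the conditional mean of the second, a sample from
the second coordinate is, jointly with the first coordinate, a sample from the first coordinate. -/
lemma map_compProd_eq_of_martingale
    {π : Measure (ProbabilityMeasure E × ProbabilityMeasure E)} [IsProbabilityMeasure π]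
    (h : ∀ (a : C(ProbabilityMeasure E, ℝ)) (f : C(E, ℝ)),
        ∫ p, a p.1 * ∫ x, f x ∂(p.2 : Measure E) ∂π =
          ∫ p, a p.1 * ∫ x, f x ∂(p.1 : Measure E) ∂π) :
    (π ⊗ₘ (tautKernel E).comap Prod.snd measurable_snd).map (fun q => (q.1.1, q.2)) =
      π.map Prod.fst ⊗ₘ tautKernel E := by
  have : IsProbabilityMeasure (π.map Prod.fst) :=
    Measure.isProbabilityMeasure_map measurable_fst.aemeasurable
  have hm : Measurable fun q : (ProbabilityMeasure E × ProbabilityMeasure E) × E =>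
      (q.1.1, q.2) := by fun_prop
  have : IsProbabilityMeasure ((π ⊗ₘ (tautKernel E).comap Prod.snd measurable_snd).map
      (fun q => (q.1.1, q.2))) := Measure.isProbabilityMeasure_map hm.aemeasurable
  refine Measure.ext_of_integral_mul_boundedContinuousFunction fun a f => ?_
  have hc : Continuous fun p : ProbabilityMeasure E × E => a p.1 * f p.2 := by fun_prop
  have hi (m : Measure (ProbabilityMeasure E × E)) [IsFiniteMeasure m] :
      Integrable (fun p : ProbabilityMeasure E × E => a p.1 * f p.2) m :=
    (BoundedContinuousFunction.mkOfCompact ⟨_, hc⟩).integrable _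
  have hi' : Integrable (fun q : (ProbabilityMeasure E × ProbabilityMeasure E) × E =>
      a q.1.1 * f q.2) (π ⊗ₘ (tautKernel E).comap Prod.snd measurable_snd) :=
    (hi (Measure.map (fun q : (ProbabilityMeasure E × ProbabilityMeasure E) × E =>
      (q.1.1, q.2)) _)).comp_measurable hm
  have h1 := Measure.integral_compProd hi'
  have h2 := Measure.integral_compProd (hi (π.map Prod.fst ⊗ₘ tautKernel E))
  simp only [integral_const_mul] at h1 h2
  rw [integral_map hm.aemeasurable hc.aestronglyMeasurable, h1, h2, integral_map
    measurable_fst.aemeasurable (by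
      exact (a.continuous.mul (ProbabilityMeasure.continuous_integral_continuousMap
        f.toContinuousMap)).aestronglyMeasurable)]
  exact h a.toContinuousMap f.toContinuousMap

variable {S : Type u} [TopologicalSpace S] [PolishSpace S] [MeasurableSpace S] [BorelSpace S]
  {ι : S → E}

/-- Laws in convex order are the laws of conditional laws given nested `σ`-algebras. A sample from
the coupling and from its second coordinate is realized on the unit interval, and a measurable left
inverse of `ι` takes it from `E` to `S`. -/
theorem exists_isLawOfCondLaw (hι : Continuous ι) (hinj : Function.Injective ι)
    {ρ₁ ρ₂ : ProbabilityMeasure (ProbabilityMeasure S)}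
    (h : ∀ φ : ProbabilityMeasure E → ℝ, Continuous φ → IsConvexFun φ →
      ∫ μ, φ (pushforward ι hι μ) ∂(ρ₁ : Measure (ProbabilityMeasure S)) ≤
        ∫ μ, φ (pushforward ι hι μ) ∂(ρ₂ : Measure (ProbabilityMeasure S))) :
    ∃ (Ω : Type v) (mΩ : MeasurableSpace Ω) (P : Measure Ω) (_ : IsProbabilityMeasure P)
      (X : Ω → S) (F₁ F₂ : MeasurableSpace Ω),
      Measurable[mΩ] X ∧ F₁ ≤ F₂ ∧ F₂ ≤ mΩ ∧
        IsLawOfCondLaw ρ₁ P X F₁ ∧ IsLawOfCondLaw ρ₂ P X F₂ := by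
  have hj : Measurable (pushforward ι hι) := measurable_pushforward hι
  obtain ⟨μ₀⟩ : Nonempty (ProbabilityMeasure S) := nonempty_of_isProbabilityMeasure (ρ₁ : Measure _)
  have : Nonempty S := nonempty_of_isProbabilityMeasure (μ₀ : Measure S)
  have hemb : MeasurableEmbedding ι := hι.measurableEmbedding hinj
  have : Nonempty E := ⟨ι (Classical.arbitrary S)⟩
  let := metrizableSpaceMetric E
  have : PolishSpace E := inferInstance
  have : Nonempty (ProbabilityMeasure E) := ⟨pushforward ι hι μ₀⟩
  let := metrizableSpaceMetric (ProbabilityMeasure E)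
  have : PolishSpace (ProbabilityMeasure E) := inferInstance
  -- The left inverse `r` of `pushforward ι hι` induced by a left inverse `g` of `ι`.
  let g : E → S := hemb.invFun
  have hg : Measurable g := hemb.measurable_invFun
  let r : ProbabilityMeasure E → ProbabilityMeasure S := fun μ => μ.map hg.aemeasurable
  have hr : Measurable r :=
    ((Measure.measurable_map g hg).comp measurable_subtype_coe).subtype_mk
  have hrj (μ : ProbabilityMeasure S) : r (pushforward ι hι μ) = μ := by
    refine Subtype.ext ?_
    change ((μ : Measure S).map ι).map g = μ
    rw [Measure.map_map hg hemb.measurable,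
      show g ∘ ι = id from funext hemb.leftInverse_invFun, Measure.map_id]
  have hkr : (tautKernel E).map g = (tautKernel S).comap r hr := by
    ext μ : 1
    rw [Kernel.map_apply _ hg]
    rfl
  have hrρ (ρ : ProbabilityMeasure (ProbabilityMeasure S)) :
      (((ρ : Measure (ProbabilityMeasure S)).map (pushforward ι hι)).map r) = ρ := by
    rw [Measure.map_map hr hj, show r ∘ pushforward ι hι = id from funext hrj, Measure.map_id]
  have hprob (ρ : ProbabilityMeasure (ProbabilityMeasure S)) :
      IsProbabilityMeasure ((ρ : Measure (ProbabilityMeasure S)).map (pushforward ι hι)) :=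
    Measure.isProbabilityMeasure_map hj.aemeasurable
  have := hprob ρ₁
  have := hprob ρ₂
  obtain ⟨π, hπ, hfst, hsnd, hmart⟩ := exists_martingale_coupling
    (ρ₁ := (ρ₁ : Measure (ProbabilityMeasure S)).map (pushforward ι hι))
    (ρ₂ := (ρ₂ : Measure (ProbabilityMeasure S)).map (pushforward ι hι)) (fun φ hφ hconv => by
      rw [integral_map hj.aemeasurable hφ.measurable.aestronglyMeasurable,
        integral_map hj.aemeasurable hφ.measurable.aestronglyMeasurable]
      exact h φ hφ hconv)
  obtain ⟨P, Z, hP, hZ, hmap⟩ : ∃ (P : Measure (ULift.{v} unitInterval))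
      (Z : ULift.{v} unitInterval → (ProbabilityMeasure E × ProbabilityMeasure E) × E),
      IsProbabilityMeasure P ∧ Measurable Z ∧
        P.map Z = π ⊗ₘ (tautKernel E).comap Prod.snd measurable_snd := by
    obtain ⟨Z, hZ, hmap⟩ :=
      (π ⊗ₘ (tautKernel E).comap Prod.snd measurable_snd).exists_measurable_map_eq
    refine ⟨volume.map ULift.up, Z ∘ ULift.down, inferInstance, hZ.comp measurable_down, ?_⟩
    rw [Measure.map_map (hZ.comp measurable_down) measurable_up]
    exact hmap
  let X : ULift.{v} unitInterval → S := fun ω => g (Z ω).2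
  have hX : Measurable X := hg.comp (measurable_snd.comp hZ)
  have hW₂ : Measurable fun ω => (Z ω).1 := measurable_fst.comp hZ
  have hW₁ : Measurable fun ω => (Z ω).1.1 := measurable_fst.comp hW₂
  have hlaw₂ : P.map (fun ω => (Z ω).1) = π := by
    have h1 : (P.map Z).fst = π := by rw [hmap, Measure.fst_compProd]
    rw [← h1, Measure.fst, Measure.map_map measurable_fst hZ]
    rfl
  have hlaw₁ : P.map (fun ω => (Z ω).1.1) = π.map Prod.fst := by
    rw [← hlaw₂, Measure.map_map measurable_fst hW₂]
    rfl
  refine ⟨ULift.{v} unitInterval, inferInstance, P, hP, X,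
    MeasurableSpace.comap (fun ω => (Z ω).1.1) inferInstance,
    MeasurableSpace.comap (fun ω => (Z ω).1) inferInstance, hX, ?_, hW₂.comap_le, ?_, ?_⟩
  · exact (measurable_fst.comp (comap_measurable fun ω => (Z ω).1)).comap_le
  · refine ⟨fun ω => r (Z ω).1.1, isCondLaw_comap_of_map_eq hW₁ hX hr ?_, ?_⟩
    · rw [hlaw₁, ← hkr, Measure.compProd_map hg, ← map_compProd_eq_of_martingale hmart,
        Measure.map_map (by fun_prop) (by fun_prop), ← hmap, Measure.map_map (by fun_prop) hZ]
      rfl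
    · rw [← hrρ ρ₁, ← hfst, ← hlaw₁, Measure.map_map hr hW₁]
      rfl
  · have hr₂ : Measurable fun p : ProbabilityMeasure E × ProbabilityMeasure E => r p.2 :=
      hr.comp measurable_snd
    refine ⟨fun ω => r (Z ω).1.2,
      isCondLaw_comap_of_map_eq hW₂ hX hr₂ ?_, ?_⟩
    · have hk2 : (tautKernel S).comap _ hr₂ =
          ((tautKernel E).comap (Prod.snd : ProbabilityMeasure E × ProbabilityMeasure E → _)
            measurable_snd).map g := by
        ext p : 1
        rw [Kernel.map_apply _ hg]
        rfl
      rw [hlaw₂, hk2, Measure.compProd_map hg, ← hmap,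
        Measure.map_map (by fun_prop) hZ]
      rfl
    · rw [← hrρ ρ₂, ← hsnd, ← hlaw₂, Measure.map_map measurable_snd hW₂,
        Measure.map_map hr (measurable_snd.comp hW₂)]
      rfl

end Realization

end ConvexOrder

theorem mainTheorem6 {S : Type u} {E : Type w}
    [TopologicalSpace S] [PolishSpace S] [MeasurableSpace S] [BorelSpace S]
    [TopologicalSpace E] [MeasurableSpace E] [BorelSpace E]
    (ι : S → E) (hι : IsMetrizableCompactification ι)
    (ρ₁ ρ₂ : ProbabilityMeasure (ProbabilityMeasure S)) :
    (∀ φ : ProbabilityMeasure E → ℝ, Continuous φ → IsConvexFun φ →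
      ∫ μ, φ (pushforward ι hι.isDenseEmbedding.continuous μ)
          ∂(ρ₁ : Measure (ProbabilityMeasure S)) ≤
        ∫ μ, φ (pushforward ι hι.isDenseEmbedding.continuous μ)
          ∂(ρ₂ : Measure (ProbabilityMeasure S)))
    ↔
    ∃ (Ω : Type v) (mΩ : MeasurableSpace Ω) (P : Measure Ω) (_ : IsProbabilityMeasure P)
      (X : Ω → S) (F₁ F₂ : MeasurableSpace Ω),
      Measurable[mΩ] X ∧ F₁ ≤ F₂ ∧ F₂ ≤ mΩ ∧
        IsLawOfCondLaw ρ₁ P X F₁ ∧ IsLawOfCondLaw ρ₂ P X F₂ := by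
  have := hι.compactSpace
  have := hι.metrizableSpace
  constructor
  · exact exists_isLawOfCondLaw _ hι.isDenseEmbedding.injective
  · rintro ⟨Ω, mΩ, P, hP, X, F₁, F₂, hX, h₁₂, h₂, hρ₁, hρ₂⟩ φ hφ hconv
    exact integral_le_of_isLawOfCondLaw _ hX h₁₂ h₂ hρ₁ hρ₂ hφ hconv
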